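/- Identify subsets of $\mathbb{N}$ with their characteristic sequences in $2^\omega$, let $[\sigma]$ be the set of all $X\in 2^\omega$ extending the finite binary string $\sigma$, and let $\oplus$ and $\le_{\mathrm T}$ denote the join and Turing reducibility. Borel probability measures on $2^\omega$ are represented by reals through fast Cauchy sequences of basic measures, as follows. For $R\in 2^\omega$ and $n\in\mathbb{N}$ let $c_n^R=4^{-n}\sum_{i<4^n}\delta_{x_{n,i}}$, where $x_{n,i}(j)=R(\langle n,\langle i,j\rangle\rangle)$ for $j<n$ and $x_{n,i}(j)=0$ for $j\ge n$, with $\langle\cdot,\cdot\rangle$ the standard pairing function on $\mathbb{N}$. Let $d(\mu,\nu)=\sup_\sigma 2^{-|\sigma|}\,|\mu[\sigma]-\nu[\sigma]|$, a metric for the weak-* topology. Put $q_0^R=c_0^R$, and $q_{n+1}^R=c_{n+1}^R$ if $d(c_{n+1}^R,q_n^R)\le 2^{-n}$, $q_{n+1}^R=q_n^R$ otherwise. The sequence $(q_n^R)_n$ converges in the weak-* topology to a Borel probability measure $\rho(R)$. A real $R$ with $\rho(R)=\mu$ is called a representation of $\mu$. For a representation $\hat R$ of $\mu$, an $\hat R$-test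 is a sequence $(V_n)_{n\in\mathbb{N}}$ of uniformly $\Sigma^0_1(\hat R)$ classes $V_n\subseteq 2^\omega$ with $\mu(V_n)\le 2^{-n}$ for all $n$. A real $X$ is $\hat R$-random if $X\notin\bigcap_n V_n$ for every $\hat R$-test $(V_n)$, and $X$ is $\mu$-random if it is $\hat R$-random for some representation $\hat R$ of $\mu$. **Theorem.** Let $R\in 2^\omega$ be a representation of a Borel probability measure $\mu$ on $2^\omega$, and let $A\in 2^\omega$. If 1. $A$ is r.e. (as a subset of $\mathbb{N}$), 2. $A$ is $\mu$-random (the witnessing representation of $\mu$ need not be $R$), and 3. $A$ is not an atom of $\mu$, i.e. $\mu\{A\}=0$, then $R\oplus A\ge_{\mathrm T}\emptyset'$, where $\emptyset'$ is the halting problem. -/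

import Mathlib

open MeasureTheory Filter Topology

namespace CantorRandom

/-- Cantor space `2^ω`.  Its elements ("reals") are identified with subsets of `ℕ` through their
characteristic sequences. -/
abbrev Cantor : Type := ℕ → Bool

/-! ### Computability relative to a real -/

/-- The characteristic function of a real, in the form in which Mathlib's `RecursiveIn` and
`TuringReducible` take oracles and reducible functions. -/
def chi (X : Cantor) : ℕ →. ℕ := fun n => Part.some (X n).toNat

/-- Turing reducibility `X ≤_T Y` of reals. -/
def TuringLE (X Y : Cantor) : Prop := TuringReducible (chi X) (chi Y)

/-- The join `X ⊕ Y`: `X` on the even numbers, `Y` on the odd numbers. -/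
def oplus (X Y : Cantor) : Cantor := fun n => if n % 2 = 0 then X (n / 2) else Y (n / 2)

/-- The empty set, as a real. -/
def emptyReal : Cantor := fun _ => false

open Classical in
/-- The halting problem `∅' = {e : φ_e(e)↓}`, with Mathlib's Gödel numbering of the partial
recursive functions. -/
noncomputable def haltingReal : Cantor :=
  fun e => decide ((Nat.Partrec.Code.eval (Denumerable.ofNat Nat.Partrec.Code e) e).Dom)

/-- The real `A` is r.e. as a subset of `ℕ`. -/
def IsRE (A : Cantor) : Prop := REPred fun n => A n = true

/-- A predicate is r.e. in `Z` if it is the domain of a partial function recursive in `Z`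
(Mathlib's `REPred`, relativized). -/
def REIn {α : Type*} [Primcodable α] (Z : Cantor) (p : α → Prop) : Prop :=
  RecursiveIn {chi Z} fun a => Part.assert (p a) fun _ => Part.some ()

/-- The basic clopen set `[σ]` of all reals that extend the finite binary string `σ`. -/
def cylinder (σ : List Bool) : Set Cantor := {X | ∀ i (h : i < σ.length), X i = σ[i]}

/-- `(V n)` is a sequence of uniformly `Σ⁰₁(Z)` classes: `V n` is the union of the `[σ]` with
`(n, σ) ∈ W`, for one set `W` that is r.e. in `Z`. -/
def UniformlySigma01 (Z : Cantor) (V : ℕ → Set Cantor) : Prop :=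
  ∃ W : Set (ℕ × List Bool), REIn Z (fun p => p ∈ W) ∧
    ∀ n, V n = ⋃ σ ∈ {σ : List Bool | (n, σ) ∈ W}, cylinder σ

/-! ### Representations of measures

Measures are named by fast Cauchy sequences of basic measures (rational convex combinations of
Dirac measures at sequences that are eventually zero), coded by reals. -/

/-- The distance `d(μ, ν) = sup_σ 2^{-|σ|} |μ[σ] - ν[σ]|` on the Borel probability measures on
Cantor space; it induces the weak-* topology. -/
noncomputable def measDist (μ ν : ProbabilityMeasure Cantor) : ℝ :=
  ⨆ σ : List Bool, (1 / 2 : ℝ) ^ σ.length *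
    |(μ : Measure Cantor).real (cylinder σ) - (ν : Measure Cantor).real (cylinder σ)|

/-- The `i`-th point of the `n`-th block of `R`: a string of length `n`, continued by zeros. -/
def blockPoint (R : Cantor) (n i : ℕ) : Cantor :=
  fun j => decide (j < n) && R (Nat.pair n (Nat.pair i j))

/-- The basic measure coded by the `n`-th block of `R`: the average of the Dirac measures at its
`4^n` points.  These averages, over all blocks, are `2^{-n}`-dense. -/
noncomputable def blockMeasure (R : Cantor) (n : ℕ) : ProbabilityMeasure Cantor :=
  ⟨((4 : ENNReal) ^ n)⁻¹ • ∑ i ∈ Finset.range (4 ^ n), Measure.dirac (blockPoint R n i), by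
    constructor
    simp only [Measure.smul_apply, Measure.coe_finsetSum, Finset.sum_apply, measure_univ,
      Finset.sum_const, Finset.card_range, smul_eq_mul, nsmul_eq_mul, mul_one]
    push_cast
    exact ENNReal.inv_mul_cancel (by positivity) (by finiteness)⟩

open Classical in
/-- The Cauchy sequence of basic measures coded by `R`: the sequence of block measures, where a
block that would violate `d(q (n+1), q n) ≤ 2^{-n}` is ignored. -/
noncomputable def cauchyName (R : Cantor) : ℕ → ProbabilityMeasure Cantor
  | 0 => blockMeasure R 0
  | n + 1 => if measDist (blockMeasure R (n + 1)) (cauchyName R n) ≤ (1 / 2 : ℝ) ^ n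
      then blockMeasure R (n + 1) else cauchyName R n

theorem le_measDist (μ ν : ProbabilityMeasure Cantor) (σ : List Bool) :
    (1 / 2 : ℝ) ^ σ.length *
      |(μ : Measure Cantor).real (cylinder σ) - (ν : Measure Cantor).real (cylinder σ)| ≤
      measDist μ ν := by
  refine le_ciSup (f := fun σ : List Bool => (1 / 2 : ℝ) ^ σ.length *
    |(μ : Measure Cantor).real (cylinder σ) - (ν : Measure Cantor).real (cylinder σ)|) ?_ σ
  refine ⟨1, ?_⟩
  rintro _ ⟨τ, rfl⟩
  have h1 : (1 / 2 : ℝ) ^ τ.length ≤ 1 := pow_le_one₀ (by norm_num) (by norm_num)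
  have h2 : |(μ : Measure Cantor).real (cylinder τ) - (ν : Measure Cantor).real (cylinder τ)| ≤ 1 :=
    abs_sub_le_of_nonneg_of_le measureReal_nonneg measureReal_le_one measureReal_nonneg
      measureReal_le_one
  exact mul_le_one₀ h1 (abs_nonneg _) h2

theorem measDist_cauchyName (R : Cantor) (n : ℕ) :
    measDist (cauchyName R (n + 1)) (cauchyName R n) ≤ (1 / 2 : ℝ) ^ n := by
  rw [cauchyName]
  split_ifs with h
  · exact h
  · have : measDist (cauchyName R n) (cauchyName R n) = 0 := by simp [measDist]
    rw [this]; positivity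

theorem cylinder_eq_preimage (σ : List Bool) :
    cylinder σ = ⋂ i : Fin σ.length, (fun X : Cantor => X i) ⁻¹' {σ[i]} := by
  ext X
  simp [cylinder, Fin.forall_iff]

theorem isClopen_cylinder (σ : List Bool) : IsClopen (cylinder σ) := by
  rw [cylinder_eq_preimage]
  exact isClopen_iInter_of_finite fun i => (isClopen_discrete _).preimage (continuous_apply _)

theorem cylinder_inter_cylinder (σ τ : List Bool) (h : (cylinder σ ∩ cylinder τ).Nonempty) :
    cylinder σ ∩ cylinder τ = cylinder (if σ.length ≤ τ.length then τ else σ) := by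
  obtain ⟨Y, hY1, hY2⟩ := h
  have key : ∀ {a b : List Bool}, Y ∈ cylinder a → Y ∈ cylinder b → a.length ≤ b.length →
      cylinder b ⊆ cylinder a := by
    intro a b ha hb hl X hX i hi
    rw [hX i (by omega), ← hb i (by omega), ha i hi]
  split_ifs with hl
  · exact Set.inter_eq_right.2 (key hY1 hY2 hl)
  · exact Set.inter_eq_left.2 (key hY2 hY1 (by omega))

theorem generateFrom_cylinder :
    (inferInstance : MeasurableSpace Cantor) =
      MeasurableSpace.generateFrom (Set.range cylinder) := by
  apply le_antisymm
  · refine iSup_le fun i => ?_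
    rintro _ ⟨s, -, rfl⟩
    have : (fun X : Cantor => X i) ⁻¹' s =
        ⋃ σ ∈ {σ : List Bool | ∃ h : i < σ.length, σ[i] ∈ s}, cylinder σ := by
      ext X
      simp only [Set.mem_preimage, Set.mem_iUnion, Set.mem_ofPred_eq, exists_prop]
      constructor
      · intro hX
        exact ⟨(List.range (i + 1)).map X, ⟨by simp, by simpa using hX⟩,
          fun j hj => by simp⟩
      · rintro ⟨σ, ⟨h, hs⟩, hX⟩
        rw [hX i h]; exact hs
    rw [this]
    refine MeasurableSet.biUnion (Set.to_countable _) fun σ _ => ?_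
    exact MeasurableSpace.measurableSet_generateFrom ⟨σ, rfl⟩
  · refine MeasurableSpace.generateFrom_le ?_
    rintro _ ⟨σ, rfl⟩
    exact (isClopen_cylinder σ).isOpen.measurableSet

theorem ext_of_cylinder (μ ν : ProbabilityMeasure Cantor)
    (h : ∀ σ, (μ : Measure Cantor).real (cylinder σ) = (ν : Measure Cantor).real (cylinder σ)) :
    μ = ν := by
  apply Subtype.ext
  have hμ : IsProbabilityMeasure (μ : Measure Cantor) := μ.2
  have hν : IsProbabilityMeasure (ν : Measure Cantor) := ν.2
  refine @ext_of_generate_finite Cantor _ (μ : Measure Cantor) (ν : Measure Cantor) _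
    generateFrom_cylinder ?_ inferInstance ?_ (by rw [hμ.measure_univ, hν.measure_univ])
  · rintro _ ⟨σ, rfl⟩ _ ⟨τ, rfl⟩ hne
    exact ⟨_, (cylinder_inter_cylinder σ τ hne).symm⟩
  · rintro _ ⟨σ, rfl⟩
    exact (measureReal_eq_measureReal_iff).1 (h σ)

/-- The sequence of basic measures coded by a real always converges in the weak-* topology. -/
theorem exists_tendsto_cauchyName (R : Cantor) :
    ∃ μ : ProbabilityMeasure Cantor, Tendsto (cauchyName R) atTop (𝓝 μ) := by
  have hlim : ∀ σ, ∃ l : ℝ, Tendsto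
      (fun n => (cauchyName R n : Measure Cantor).real (cylinder σ)) atTop (𝓝 l) := by
    intro σ
    refine cauchySeq_tendsto_of_complete
      (cauchySeq_of_le_geometric (1 / 2) (2 ^ σ.length) (by norm_num) fun n => ?_)
    have h := (le_measDist _ _ σ).trans (measDist_cauchyName R n)
    rw [dist_comm, Real.dist_eq]
    have h2 : (0 : ℝ) < 2 ^ σ.length := by positivity
    rw [one_div, inv_pow, inv_mul_le_iff₀ h2] at h
    simpa using h
  choose l hl using hlim
  have hcl : ∀ μ, MapClusterPt μ atTop (cauchyName R) →
      ∀ σ, (μ : Measure Cantor).real (cylinder σ) = l σ := by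
    intro μ hμ σ
    have hc : Tendsto (fun ν : ProbabilityMeasure Cantor =>
        (ν : Measure Cantor).real (cylinder σ)) (𝓝 μ)
        (𝓝 ((μ : Measure Cantor).real (cylinder σ))) := by
      have := ProbabilityMeasure.tendsto_measure_of_isClopen_of_tendsto
        (tendsto_id (x := 𝓝 μ)) (isClopen_cylinder σ)
      exact (NNReal.continuous_coe.tendsto _).comp this
    have h1 := MapClusterPt.tendsto_comp hc hμ
    have h2 := h1.neBot.mono (inf_le_inf_left _ (hl σ))
    exact tendsto_nhds_unique' h2 inf_le_left inf_le_right
  obtain ⟨μ, hμ⟩ := exists_clusterPt_of_compactSpace (map (cauchyName R) atTop)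
  refine ⟨μ, le_nhds_of_unique_clusterPt fun ν hν => ?_⟩
  exact ext_of_cylinder _ _ fun σ => by rw [hcl ν hν σ, hcl μ hμ σ]

/-- The map `ρ : 2^ω → P(2^ω)`: `ρ(R)` is the limit of the Cauchy sequence coded by `R`. -/
noncomputable def rho (R : Cantor) : ProbabilityMeasure Cantor :=
  (exists_tendsto_cauchyName R).choose

/-- `R` is a representation of `μ`. -/
def IsRepresentation (R : Cantor) (μ : ProbabilityMeasure Cantor) : Prop := rho R = μ

/-! ### Randomness -/

/-- `(V n)` is an `(R, B)`-test, for a representation `R` of `μ`. -/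
def IsTest (μ : ProbabilityMeasure Cantor) (R B : Cantor) (V : ℕ → Set Cantor) : Prop :=
  UniformlySigma01 (oplus R B) V ∧ ∀ n, (μ : Measure Cantor).real (V n) ≤ (1 / 2 : ℝ) ^ n

/-- `X` is `(R, B)`-random, for a representation `R` of `μ`: it passes every `(R, B)`-test. -/
def IsRandomFor (μ : ProbabilityMeasure Cantor) (R B X : Cantor) : Prop :=
  ∀ V, IsTest μ R B V → X ∉ ⋂ n, V n

/-- `MLR_μ(B)`: the reals that are `(R, B)`-random for some representation `R` of `μ`. -/
def MLR (μ : ProbabilityMeasure Cantor) (B : Cantor) : Set Cantor :=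
  {X | ∃ R, IsRepresentation R μ ∧ IsRandomFor μ R B X}

/-- `A` is an atom of `μ`. -/
def IsAtomOf (A : Cantor) (μ : ProbabilityMeasure Cantor) : Prop := (μ : Measure Cantor) {A} ≠ 0

end CantorRandom

open CantorRandom

/-!
A random real that is not an atom of `μ` cannot be caught in small neighbourhoods by its own
computable approximation at the moments when `∅'` changes.  Let `A_t` be the finite approximations
to the r.e. set `A`.  When `m` enters `∅'` at stage `t`, consider all initial segments `σ` of `A_t`
with `μ[σ] < 2^{-m}`.  Their union is the cylinder of the shortest one, so it has measure at
most `2^{-m}`, and taking the union over all `m > n` gives a set of measure at most `2^{-n}`.  This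
is a test relative to *every* representation `S` of `μ`, since `μ[σ] < 2^{-m}` is `Σ⁰₁(S)`
(`uniformlySigma01_catchTest`, `measureReal_catchTest_le`).  Because the definition of the test does
not mention a representation, the one that witnesses the randomness of `A` need not be `R`.

So `A` avoids some class of the test, say the `n`-th.  With `R ⊕ A` as an oracle, search for `l`
with `μ[A ↾ l] < 2^{-m}`, which exists as `A` is not an atom, and then for `t` with
`A_t ↾ l = A ↾ l`.  If `m > n` entered `∅'` at a stage after `t`, then `A` would be caught by the
test; hence `m ∈ ∅'` is decided by stage `t` (`haltsBy_of_notMem_catchTest`,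
`haltingReal_le_oplus`).

On the computability side, every use of an oracle is a search for an initial segment of it that
satisfies a primitive recursive condition (`recursiveIn_search`).  The measure named by `R` enters
only through `CertifiedSmall`, an inequality between natural numbers that depends on finitely many
bits of `R` (`certifiedSmall_congr`).
-/

namespace CantorRandom

/-! ### Searches relative to an oracle -/

/-- The initial segment of `Z` of length `n`. -/
def initSeg (Z : Cantor) (n : ℕ) : List Bool := (List.range n).map Z

@[simp] theorem length_initSeg (Z : Cantor) (n : ℕ) : (initSeg Z n).length = n := by
  simp [initSeg]

theorem initSeg_succ (Z : Cantor) (n : ℕ) : initSeg Z (n + 1) = initSeg Z n ++ [Z n] := by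
  simp [initSeg, List.range_succ]

theorem initSeg_getD (Z : Cantor) {n i : ℕ} (h : i < n) : (initSeg Z n).getD i false = Z i := by
  simp [initSeg, h]

open Encodable in
theorem recursiveIn_encode_initSeg (Z : Cantor) :
    Nat.RecursiveIn {chi Z} fun n => Part.some (encode (initSeg Z n)) := by
  have hS : Primrec fun p : ℕ => encode
      (((decode (α := List Bool) p.unpair.1).getD []) ++ [decide (p.unpair.2 = 1)]) := by
    refine Primrec.encode.comp (Primrec.list_append.comp ?_ ?_)
    · exact Primrec.option_getD.comp (Primrec.decode.comp (Primrec.fst.comp Primrec.unpair))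
        (Primrec.const _)
    · exact Primrec.list_cons.comp (PrimrecPred.decide (Primrec.eq.comp
        (Primrec.snd.comp Primrec.unpair) (Primrec.const 1))) (Primrec.const _)
  have hZ : Nat.RecursiveIn {chi Z} (chi Z) := .oracle _ rfl
  have hstep := Nat.RecursiveIn.comp (Nat.Primrec.recursiveIn (O := {chi Z}) (Primrec.nat_iff.1 hS))
    (.pair (.comp .right .right) (.comp hZ (.comp .left .right)))
  have hnil : Nat.RecursiveIn {chi Z} fun _ => Part.some (encode ([] : List Bool)) :=
    Nat.Primrec.recursiveIn (Primrec.nat_iff.1 (Primrec.const (encode ([] : List Bool))))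
  have hrec := Nat.RecursiveIn.comp (.prec hnil hstep)
    (Nat.Primrec.recursiveIn (O := {chi Z}) (Primrec.nat_iff.1
      (Primrec₂.natPair.comp (Primrec.const 0) Primrec.id)))
  refine hrec.of_eq fun n => ?_
  simp only [id, Part.coe_some, Part.bind_eq_bind, Part.bind_some, Nat.unpair_pair]
  induction n with
  | zero => simp [initSeg]
  | succ n ih =>
    simp only [ih]
    have hbit : (Part.some n >>= chi Z) = Part.some (Z n).toNat := Part.bind_some _ _
    simp [Seq.seq, initSeg_succ, hbit]

open Encodable in
/-- A search through the initial segments of the oracle is recursive in the oracle: look for the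
first `k` such that the initial segment of length `k` satisfies `P`, and return the value of `g`
there.  Every use of the oracle below goes through this form, so that only the primitive
recursiveness of relations between finite objects has to be checked. -/
theorem recursiveIn_search {α β : Type*} [Primcodable α] [Primcodable β] (Z : Cantor)
    {P : α → List Bool → Bool} {g : α → List Bool → β} (hP : Primrec₂ P) (hg : Primrec₂ g) :
    RecursiveIn {chi Z} fun a =>
      (Nat.rfind fun k => Part.some (P a (initSeg Z k))).map fun k => g a (initSeg Z k) := by
  have hL := recursiveIn_encode_initSeg Z
  have hdec : ∀ {γ : Type} [Primcodable γ] {f : α → List Bool → γ}, Primrec₂ f →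
      Primrec fun p : ℕ => (decode (α := α) p.unpair.1).bind fun a =>
        (decode (α := List Bool) p.unpair.2).map fun l => f a l := by
    intro γ _ f hf
    refine Primrec.option_bind (Primrec.decode.comp (Primrec.fst.comp Primrec.unpair)) ?_
    refine Primrec.option_map (Primrec.decode.comp
      (Primrec.snd.comp (Primrec.unpair.comp Primrec.fst))) ?_
    exact hf.comp (Primrec.snd.comp Primrec.fst) Primrec.snd
  -- The test as a function on codes; it fails (takes the value `1`) on numbers that code nothing.
  have hP' := Nat.RecursiveIn.comp (Nat.Primrec.recursiveIn (O := {chi Z}) (Primrec.nat_iff.1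
    ((Primrec.dom_bool fun b => if b then 0 else 1).comp
      (Primrec.option_getD.comp (hdec hP) (Primrec.const false)))))
    (.pair .left (.comp hL .right))
  have hg' := Nat.RecursiveIn.comp (Nat.Primrec.recursiveIn (O := {chi Z}) (Primrec.nat_iff.1
    (Primrec.option_getD.comp (hdec (Primrec.encode.comp₂ hg)) (Primrec.const 0))))
    (.pair .left (.comp hL .right))
  have hid : Nat.RecursiveIn {chi Z} fun n => Part.some n :=
    Nat.Primrec.recursiveIn Nat.Primrec.id
  refine (Nat.RecursiveIn.comp hg' (.pair hid (.rfind hP'))).of_eq fun n => ?_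
  rcases hn : decode (α := α) n with _ | a
  · have : (Nat.rfind fun _ : ℕ => Part.some false) = Part.none := by
      refine Part.eq_none_iff.2 fun k hk => ?_
      simpa using Nat.rfind_spec hk
    simp [Seq.seq, hn, this]
  · simp [Seq.seq, hn, Part.bind_some_eq_map, Part.map_map]
    exact congrArg (fun h => Part.map h _) (funext fun k => by simp [hn])

theorem reIn_of_search {α : Type*} [Primcodable α] (Z : Cantor) {p : α → Prop}
    {P : α → List Bool → Prop} (hP : PrimrecRel P) (h : ∀ a, p a ↔ ∃ k, P a (initSeg Z k)) :
    REIn Z p := by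
  classical
  refine (recursiveIn_search Z hP.decide (g := fun _ _ => ()) (Primrec.const ())).of_eq fun a => ?_
  refine Part.ext fun u => ?_
  simp only [Part.mem_map_iff, exists_and_right, Part.mem_assert_iff, h]
  constructor
  · rintro ⟨⟨k, hk⟩, -⟩
    exact ⟨⟨k, by simpa [eq_comm] using Nat.rfind_spec hk⟩, Part.mem_some _⟩
  · rintro ⟨⟨k, hk⟩, -⟩
    obtain ⟨l, hl, -⟩ := Nat.rfind_min' (p := fun k => decide (P a (initSeg Z k))) (m := k) (by simpa)
    exact ⟨⟨l, hl⟩, trivial⟩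

theorem turingLE_of_search {X Z : Cantor} {P : ℕ → List Bool → Prop} {g : ℕ → List Bool → Bool}
    (hP : PrimrecRel P) (hg : Primrec₂ g) (hex : ∀ n, ∃ k, P n (initSeg Z k))
    (hcorrect : ∀ n k, P n (initSeg Z k) → g n (initSeg Z k) = X n) : TuringLE X Z := by
  classical
  refine (recursiveIn_search Z hP.decide ((Primrec.dom_bool Bool.toNat).comp₂ hg)).of_eq fun n => ?_
  obtain ⟨k, hk⟩ := hex n
  obtain ⟨l, hl, -⟩ := Nat.rfind_min' (p := fun k => decide (P n (initSeg Z k))) (m := k) (by simpa)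
  have hl' := Nat.rfind_spec hl
  simp only [PFun.coe_val, Part.mem_some_iff] at hl'
  exact Part.eq_some_iff.2 ((Part.mem_map_iff _).2
    ⟨l, hl, by rw [hcorrect n l (by simpa using hl'.symm)]⟩)

/-! ### Effective bounds for the measure named by a real -/

theorem mem_cylinder_iff {X : Cantor} {σ : List Bool} :
    X ∈ cylinder σ ↔ ∀ j < σ.length, X j = σ.getD j false := by
  refine forall₂_congr fun j hj => ?_
  rw [List.getD_eq_getElem _ _ hj]

/-- The number of points of the `n`-th block of `X` that extend `σ`. -/
def blockCount (X : Cantor) (n : ℕ) (σ : List Bool) : ℕ :=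
  ((List.range (4 ^ n)).filter fun i =>
    ∀ j < σ.length, blockPoint X n i j = σ.getD j false).length

theorem blockMeasure_real_cylinder (X : Cantor) (n : ℕ) (σ : List Bool) :
    (blockMeasure X n : Measure Cantor).real (cylinder σ) = blockCount X n σ / 4 ^ n := by
  classical
  have h : (∑ i ∈ Finset.range (4 ^ n), Measure.dirac (blockPoint X n i)) (cylinder σ) =
      blockCount X n σ := by
    rw [Measure.finsetSum_apply]
    simp_rw [Measure.dirac_apply' _ (isClopen_cylinder σ).isOpen.measurableSet, Set.indicator_apply,
      Pi.one_apply, mem_cylinder_iff]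
    rw [Finset.sum_boole]
    rfl
  simp only [blockMeasure, ProbabilityMeasure.coe_mk, Measure.real, Measure.smul_apply, h]
  simp [div_eq_inv_mul]

/-- Past the first `N` bits, the points of the first `N` blocks are zero; so they lie in `[σ]` only
if `σ` is zero there as well, in which case the later bits of `σ` do not matter. -/
theorem blockCount_of_le_length (X : Cantor) {N k : ℕ} (hk : k ≤ N) {σ : List Bool}
    (hσ : N ≤ σ.length) :
    blockCount X k σ = if ∀ j < σ.length, N ≤ j → σ.getD j false = false
      then blockCount X k (σ.take N) else 0 := by
  have hzero : ∀ i j, N ≤ j → blockPoint X k i j = false := fun i j hj => by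
    simp [blockPoint, show ¬ j < k by omega]
  have hl : (σ.take N).length = N := by simp [hσ]
  have hget : ∀ j < N, (σ.take N).getD j false = σ.getD j false := fun j hj => by
    simp [hj]
  split_ifs with h
  · unfold blockCount
    congr 2
    funext i
    rw [decide_eq_decide, hl]
    constructor
    · intro H j hj
      rw [H j (by omega), hget j hj]
    · intro H j hj
      rcases lt_or_ge j N with hjN | hjN
      · rw [H j hjN, hget j hjN]
      · rw [h j hj hjN, hzero i j hjN]
  · push Not at h
    obtain ⟨j, hj, hjN, hne⟩ := h
    unfold blockCount
    rw [List.length_eq_zero_iff, List.filter_eq_nil_iff]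
    intro i _ H
    rw [decide_eq_true_eq] at H
    exact hne (by rw [← H j hj, hzero i j hjN])

/-- Between two of the first `N` blocks, the supremum in `measDist` is decided by the strings of
length at most `N`. -/
theorem measDist_blockMeasure_le_iff (X : Cantor) {N k m : ℕ} (hk : k ≤ N) (hm : m ≤ N) {r : ℝ}
    (hr : 0 ≤ r) :
    measDist (blockMeasure X k) (blockMeasure X m) ≤ r ↔
      ∀ σ : List Bool, σ.length ≤ N → (1 / 2 : ℝ) ^ σ.length *
        |(blockCount X k σ / 4 ^ k : ℝ) - blockCount X m σ / 4 ^ m| ≤ r := by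
  constructor
  · intro h σ _
    have := le_measDist (blockMeasure X k) (blockMeasure X m) σ
    rw [blockMeasure_real_cylinder, blockMeasure_real_cylinder] at this
    exact this.trans h
  · intro h
    refine ciSup_le fun σ => ?_
    rw [blockMeasure_real_cylinder, blockMeasure_real_cylinder]
    rcases le_total σ.length N with hσ | hσ
    · exact h σ hσ
    rw [blockCount_of_le_length X hk hσ, blockCount_of_le_length X hm hσ]
    split_ifs
    · have hl : (σ.take N).length = N := by simp [hσ]
      refine le_trans ?_ (h (σ.take N) hl.le)
      gcongr ?_ * _
      exact pow_le_pow_of_le_one (by norm_num) (by norm_num) (by omega)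
    · simpa using hr

/-- A list of all binary strings of length at most `n`. -/
def shortStrings : ℕ → List (List Bool)
  | 0 => [[]]
  | n + 1 => [] :: (shortStrings n).flatMap fun σ => [false :: σ, true :: σ]

theorem mem_shortStrings {n : ℕ} {σ : List Bool} : σ ∈ shortStrings n ↔ σ.length ≤ n := by
  induction n generalizing σ with
  | zero => simp [shortStrings]
  | succ n ih =>
    rcases σ with _ | ⟨b, σ⟩
    · simp [shortStrings]
    · cases b <;> simp [shortStrings, ih]

/-- The test `d(c_{n+1}, c_m) ≤ 2^{-n}` for the blocks of `X`, with denominators cleared and the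
supremum restricted to short strings. -/
def BlocksClose (X : Cantor) (n m : ℕ) : Prop :=
  ∀ σ ∈ shortStrings (n + 1),
    2 ^ n * (blockCount X (n + 1) σ * 4 ^ m) ≤
      2 ^ n * (blockCount X m σ * 4 ^ (n + 1)) + 2 ^ σ.length * (4 ^ (n + 1) * 4 ^ m) ∧
    2 ^ n * (blockCount X m σ * 4 ^ (n + 1)) ≤
      2 ^ n * (blockCount X (n + 1) σ * 4 ^ m) + 2 ^ σ.length * (4 ^ (n + 1) * 4 ^ m)

instance (X : Cantor) (n m : ℕ) : Decidable (BlocksClose X n m) :=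
  inferInstanceAs (Decidable (∀ σ ∈ shortStrings (n + 1), _))

theorem blocksClose_iff (X : Cantor) {n m : ℕ} (hm : m ≤ n + 1) :
    BlocksClose X n m ↔
      measDist (blockMeasure X (n + 1)) (blockMeasure X m) ≤ (1 / 2 : ℝ) ^ n := by
  rw [measDist_blockMeasure_le_iff X le_rfl hm (by positivity)]
  simp only [BlocksClose, mem_shortStrings]
  refine forall₂_congr fun σ _ => ?_
  rw [one_div, inv_pow, inv_pow, inv_mul_le_iff₀ (by positivity), abs_sub_le_iff,
    sub_le_iff_le_add, sub_le_iff_le_add, ← div_eq_mul_inv,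
    div_add_div _ _ (by positivity) (by positivity), div_add_div _ _ (by positivity) (by positivity),
    div_le_div_iff₀ (by positivity) (by positivity), div_le_div_iff₀ (by positivity) (by positivity)]
  refine and_congr ?_ ?_
  · rw [← Nat.cast_le (α := ℝ)]
    push_cast
    ring_nf
  · rw [← Nat.cast_le (α := ℝ)]
    push_cast
    ring_nf

/-- The index of the block that serves as the `n`-th term of the Cauchy sequence coded by `X`. -/
def nameIndex (X : Cantor) : ℕ → ℕ
  | 0 => 0
  | n + 1 => if BlocksClose X n (nameIndex X n) then n + 1 else nameIndex X n

theorem nameIndex_le (X : Cantor) (n : ℕ) : nameIndex X n ≤ n := by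
  induction n with
  | zero => rfl
  | succ n ih =>
    rw [nameIndex]
    split_ifs <;> omega

theorem cauchyName_eq_blockMeasure (X : Cantor) (n : ℕ) :
    cauchyName X n = blockMeasure X (nameIndex X n) := by
  induction n with
  | zero => rfl
  | succ n ih =>
    have := blocksClose_iff X ((nameIndex_le X n).trans n.le_succ)
    rw [cauchyName, nameIndex, ih]
    simp only [this]
    split_ifs <;> rfl

theorem tendsto_cauchyName_cylinder (X : Cantor) (σ : List Bool) :
    Tendsto (fun n => (cauchyName X n : Measure Cantor).real (cylinder σ)) atTop
      (𝓝 ((rho X : Measure Cantor).real (cylinder σ))) :=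
  (NNReal.continuous_coe.tendsto _).comp
    (ProbabilityMeasure.tendsto_measure_of_isClopen_of_tendsto
      (exists_tendsto_cauchyName X).choose_spec (isClopen_cylinder σ))

theorem abs_cauchyName_sub_rho_le (X : Cantor) (σ : List Bool) (n : ℕ) :
    |(cauchyName X n : Measure Cantor).real (cylinder σ) -
      (rho X : Measure Cantor).real (cylinder σ)| ≤ 2 ^ (σ.length + 1) / 2 ^ n := by
  have hstep : ∀ k, dist ((cauchyName X k : Measure Cantor).real (cylinder σ))
      ((cauchyName X (k + 1) : Measure Cantor).real (cylinder σ)) ≤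
        2 ^ (σ.length + 1) / 2 / 2 ^ k := by
    intro k
    have h := (le_measDist _ _ σ).trans (measDist_cauchyName X k)
    rw [dist_comm, Real.dist_eq]
    rw [one_div, inv_pow, inv_mul_le_iff₀ (by positivity)] at h
    refine h.trans (le_of_eq ?_)
    rw [pow_succ, inv_pow]
    field_simp
  exact dist_le_of_le_geometric_two_of_tendsto hstep (tendsto_cauchyName_cylinder X σ) n

/-- The `s`-th term of the Cauchy sequence coded by `X` certifies, by its error bound, that the
measure named by `X` gives `[σ]` less than `2^{-m}` (denominators are cleared). -/
def CertifiedSmall (X : Cantor) (s : ℕ) (σ : List Bool) (m : ℕ) : Prop :=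
  2 ^ m * (2 ^ s * blockCount X (nameIndex X s) σ + 2 ^ (σ.length + 1) * 4 ^ nameIndex X s) <
    2 ^ s * 4 ^ nameIndex X s

theorem certifiedSmall_iff {X : Cantor} {s : ℕ} {σ : List Bool} {m : ℕ} :
    CertifiedSmall X s σ m ↔
      (cauchyName X s : Measure Cantor).real (cylinder σ) + 2 ^ (σ.length + 1) / 2 ^ s <
        (1 / 2 : ℝ) ^ m := by
  rw [cauchyName_eq_blockMeasure, blockMeasure_real_cylinder,
    div_add_div _ _ (by positivity) (by positivity), one_div, inv_pow,
    div_lt_iff₀ (by positivity), ← div_eq_inv_mul, lt_div_iff₀ (by positivity), CertifiedSmall,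
    ← Nat.cast_lt (α := ℝ)]
  push_cast
  ring_nf

theorem CertifiedSmall.rho_lt {X : Cantor} {s : ℕ} {σ : List Bool} {m : ℕ}
    (h : CertifiedSmall X s σ m) :
    (rho X : Measure Cantor).real (cylinder σ) < (1 / 2 : ℝ) ^ m := by
  have h1 := certifiedSmall_iff.1 h
  have h2 := (abs_sub_le_iff.1 (abs_cauchyName_sub_rho_le X σ s)).2
  linarith

theorem exists_certifiedSmall {X : Cantor} {σ : List Bool} {m : ℕ}
    (h : (rho X : Measure Cantor).real (cylinder σ) < (1 / 2 : ℝ) ^ m) :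
    ∃ s, CertifiedSmall X s σ m := by
  have hlim := (tendsto_cauchyName_cylinder X σ).add
    ((tendsto_pow_atTop_nhds_zero_of_lt_one (r := (1 / 2 : ℝ)) (by norm_num)
      (by norm_num)).const_mul (2 ^ (σ.length + 1)))
  rw [mul_zero, add_zero] at hlim
  obtain ⟨s, hs⟩ := (hlim.eventually_lt_const h).exists
  refine ⟨s, certifiedSmall_iff.2 ?_⟩
  rwa [one_div, inv_pow 2 s, ← div_eq_mul_inv, ← one_div] at hs

/-- A strict upper bound for the positions that the first `s` blocks of a real occupy. -/
def blockBound (s : ℕ) : ℕ := Nat.pair s (Nat.pair (4 ^ s) s)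

theorem blockCount_congr {X Y : Cantor} {s : ℕ} (hXY : ∀ p < blockBound s, X p = Y p) {n : ℕ}
    (hn : n ≤ s) (σ : List Bool) :
    blockCount X n σ = blockCount Y n σ := by
  have hpow : 4 ^ n ≤ 4 ^ s := Nat.pow_le_pow_right (by norm_num) hn
  unfold blockCount
  congr 1
  refine List.filter_congr fun i hi => ?_
  rw [decide_eq_decide]
  have hpt : blockPoint X n i = blockPoint Y n i := by
    funext j
    unfold blockPoint
    by_cases hj : j < n
    · rw [List.mem_range] at hi
      have h1 : Nat.pair i j < Nat.pair (4 ^ s) s :=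
        (Nat.pair_lt_pair_left j (hi.trans_le hpow)).trans (Nat.pair_lt_pair_right _ (hj.trans_le hn))
      have h2 : Nat.pair n (Nat.pair i j) < blockBound s := by
        refine (Nat.pair_lt_pair_right n h1).trans_le ?_
        rcases hn.eq_or_lt with rfl | hlt
        · exact le_rfl
        · exact (Nat.pair_lt_pair_left _ hlt).le
      rw [hXY _ h2]
    · simp [hj]
  rw [hpt]

theorem nameIndex_congr {X Y : Cantor} {s : ℕ} (hXY : ∀ p < blockBound s, X p = Y p) {n : ℕ}
    (hn : n ≤ s) : nameIndex X n = nameIndex Y n := by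
  induction n with
  | zero => rfl
  | succ n ih =>
    have hi := nameIndex_le Y n
    rw [nameIndex, nameIndex, ih (by omega)]
    refine if_congr ?_ rfl rfl
    simp only [BlocksClose, blockCount_congr hXY hn, blockCount_congr hXY (hi.trans (by omega))]

theorem certifiedSmall_congr {X Y : Cantor} {s : ℕ} (hXY : ∀ p < blockBound s, X p = Y p)
    (σ : List Bool) (m : ℕ) :
    CertifiedSmall X s σ m ↔ CertifiedSmall Y s σ m := by
  rw [CertifiedSmall, CertifiedSmall, nameIndex_congr hXY le_rfl,
    blockCount_congr hXY (nameIndex_le Y s)]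

/-! ### Primitive recursiveness of the bounds -/

/-- The left half of a finite initial segment of a join, continued by zeros. -/
def leftHalf (l : List Bool) : Cantor := fun i => l.getD (2 * i) false

theorem leftHalf_initSeg_oplus (R B : Cantor) {s k : ℕ} (hk : 2 * blockBound s ≤ k) :
    ∀ p < blockBound s, leftHalf (initSeg (oplus R B) k) p = R p := by
  intro p hp
  rw [leftHalf, initSeg_getD _ (by omega)]
  simp [oplus]

theorem primrec_pow : Primrec₂ fun a b : ℕ => a ^ b :=
  Primrec₂.unpaired'.1 Nat.Primrec.pow

theorem primrec_blockBound : Primrec blockBound :=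
  Primrec₂.natPair.comp Primrec.id (Primrec₂.natPair.comp
    (primrec_pow.comp (Primrec.const 4) Primrec.id) Primrec.id)

theorem primrec_shortStrings : Primrec shortStrings := by
  have hstep : Primrec₂ fun (_ : ℕ) (L : List (List Bool)) =>
      ([] : List Bool) :: L.flatMap fun σ => [false :: σ, true :: σ] := by
    refine Primrec.list_cons.comp (Primrec.const _) (Primrec.list_flatMap Primrec.snd ?_)
    have hc : ∀ b : Bool, Primrec fun p : (ℕ × List (List Bool)) × List Bool => b :: p.2 :=
      fun b => Primrec.list_cons.comp (Primrec.const b) Primrec.snd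
    exact Primrec.list_cons.comp (hc false)
      (Primrec.list_cons.comp (hc true) (Primrec.const []))
  refine (Primrec.nat_rec₁ [[]] hstep).of_eq fun n => ?_
  induction n with
  | zero => rfl
  | succ n ih =>
    simp only [shortStrings, ← ih]

theorem primrec_blockCount : Primrec fun p : (List Bool × ℕ) × List Bool =>
    blockCount (leftHalf p.1.1) p.1.2 p.2 := by
  have hR : PrimrecRel fun (j : ℕ) (q : ℕ × (List Bool × ℕ) × List Bool) =>
      blockPoint (leftHalf q.2.1.1) q.2.1.2 q.1 j = q.2.2.getD j false := by
    have hn : Primrec fun p : ℕ × ℕ × (List Bool × ℕ) × List Bool => p.2.2.1.2 :=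
      Primrec.snd.comp (Primrec.fst.comp (Primrec.snd.comp Primrec.snd))
    have hi : Primrec fun p : ℕ × ℕ × (List Bool × ℕ) × List Bool => p.2.1 :=
      Primrec.fst.comp Primrec.snd
    refine Primrec.eq.comp (Primrec.and.comp (Primrec.nat_lt.comp Primrec.fst hn).decide ?_) ?_
    · refine (Primrec.list_getD false).comp
        (Primrec.fst.comp (Primrec.fst.comp (Primrec.snd.comp Primrec.snd))) ?_
      exact Primrec.nat_mul.comp (Primrec.const 2)
        (Primrec₂.natPair.comp hn (Primrec₂.natPair.comp hi Primrec.fst))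
    · exact (Primrec.list_getD false).comp (Primrec.snd.comp (Primrec.snd.comp Primrec.snd))
        Primrec.fst
  have hS : PrimrecRel fun (i : ℕ) (p : (List Bool × ℕ) × List Bool) =>
      ∀ j < p.2.length, blockPoint (leftHalf p.1.1) p.1.2 i j = p.2.getD j false := by
    refine ((hR.forall_mem_list.comp (f := fun q : ℕ × (List Bool × ℕ) × List Bool =>
      List.range q.2.2.length) (Primrec.list_range.comp (Primrec.list_length.comp
        (Primrec.snd.comp Primrec.snd))) Primrec.id).of_eq fun q => ?_)
    simp
  exact Primrec.list_length.comp (hS.listFilter.comp (Primrec.list_range.comp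
    (primrec_pow.comp (Primrec.const 4) (Primrec.snd.comp Primrec.fst))) Primrec.id)

theorem primrecPred_blocksClose : PrimrecPred fun p : List Bool × ℕ × ℕ =>
    BlocksClose (leftHalf p.1) p.2.1 p.2.2 := by
  have hσ : Primrec fun q : List Bool × List Bool × ℕ × ℕ => q.1 := Primrec.fst
  have hl : Primrec fun q : List Bool × List Bool × ℕ × ℕ => q.2.1 :=
    Primrec.fst.comp Primrec.snd
  have hn : Primrec fun q : List Bool × List Bool × ℕ × ℕ => q.2.2.1 :=
    Primrec.fst.comp (Primrec.snd.comp Primrec.snd)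
  have hm : Primrec fun q : List Bool × List Bool × ℕ × ℕ => q.2.2.2 :=
    Primrec.snd.comp (Primrec.snd.comp Primrec.snd)
  have hn1 := Primrec.succ.comp hn
  have hcn := primrec_blockCount.comp ((hl.pair hn1).pair hσ)
  have hcm := primrec_blockCount.comp ((hl.pair hm).pair hσ)
  have h2n := primrec_pow.comp (Primrec.const 2) hn
  have h4n := primrec_pow.comp (Primrec.const 4) hn1
  have h4m := primrec_pow.comp (Primrec.const 4) hm
  have herr := Primrec.nat_mul.comp (primrec_pow.comp (Primrec.const 2)
    (Primrec.list_length.comp hσ)) (Primrec.nat_mul.comp h4n h4m)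
  have ha := Primrec.nat_mul.comp h2n (Primrec.nat_mul.comp hcn h4m)
  have hb := Primrec.nat_mul.comp h2n (Primrec.nat_mul.comp hcm h4n)
  have hR := (Primrec.nat_le.comp ha (Primrec.nat_add.comp hb herr)).and
    (Primrec.nat_le.comp hb (Primrec.nat_add.comp ha herr))
  exact hR.primrecRel.forall_mem_list.comp (primrec_shortStrings.comp
    (Primrec.succ.comp (Primrec.fst.comp Primrec.snd))) Primrec.id

theorem primrec_nameIndex : Primrec₂ fun (l : List Bool) (n : ℕ) => nameIndex (leftHalf l) n := by
  have hn : Primrec fun q : List Bool × ℕ × ℕ => q.2.1 := Primrec.fst.comp Primrec.snd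
  have hstep : Primrec₂ fun (l : List Bool) (q : ℕ × ℕ) =>
      if BlocksClose (leftHalf l) q.1 q.2 then q.1 + 1 else q.2 :=
    Primrec.ite primrecPred_blocksClose (Primrec.succ.comp hn) (Primrec.snd.comp Primrec.snd)
  refine (Primrec.nat_rec (Primrec.const 0) hstep).of_eq fun l n => ?_
  induction n with
  | zero => rfl
  | succ n ih =>
    simp only at ih ⊢
    rw [nameIndex, ← ih]

theorem primrecPred_certifiedSmall {α : Type*} [Primcodable α] {l σ : α → List Bool} {s m : α → ℕ}
    (hl : Primrec l) (hs : Primrec s) (hσ : Primrec σ) (hm : Primrec m) :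
    PrimrecPred fun a => CertifiedSmall (leftHalf (l a)) (s a) (σ a) (m a) := by
  have hi := primrec_nameIndex.comp hl hs
  have hc := primrec_blockCount.comp ((hl.pair hi).pair hσ)
  have h2 : ∀ {f : α → ℕ}, Primrec f → Primrec fun a => 2 ^ f a :=
    fun hf => primrec_pow.comp (Primrec.const 2) hf
  have h4i := primrec_pow.comp (Primrec.const 4) hi
  exact Primrec.nat_lt.comp
    (Primrec.nat_mul.comp (h2 hm) (Primrec.nat_add.comp (Primrec.nat_mul.comp (h2 hs) hc)
      (Primrec.nat_mul.comp (h2 (Primrec.succ.comp (Primrec.list_length.comp hσ))) h4i)))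
    (Primrec.nat_mul.comp (h2 hs) h4i)

/-! ### Stages of r.e. sets, the test, and the reduction -/

open Nat.Partrec (Code)

/-- The finite set of numbers enumerated within `t` steps into the domain of the partial recursive
function with code `c`, as a real. -/
def stageReal (c : Code) (t : ℕ) : Cantor := fun j => (c.evaln t j).isSome

theorem stageReal_mono (c : Code) {t u : ℕ} (h : t ≤ u) {j : ℕ} (hj : stageReal c t j = true) :
    stageReal c u j = true := by
  obtain ⟨x, hx⟩ := Option.isSome_iff_exists.1 hj
  exact Option.isSome_iff_exists.2 ⟨x, Code.evaln_mono h hx⟩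

theorem exists_stageReal_iff (c : Code) (j : ℕ) :
    (∃ t, stageReal c t j = true) ↔ (c.eval j).Dom := by
  simp only [stageReal, Option.isSome_iff_exists, Part.dom_iff_mem, Code.evaln_complete,
    Option.mem_def]
  exact exists_comm

theorem primrec_stageReal {α : Type*} [Primcodable α] {c : α → Code} {t j : α → ℕ}
    (hc : Primrec c) (ht : Primrec t) (hj : Primrec j) :
    Primrec fun a => stageReal (c a) (t a) (j a) :=
  Primrec.option_isSome.comp (Code.primrec_evaln.comp ((ht.pair hc).pair hj))

theorem IsRE.exists_code {A : Cantor} (hA : IsRE A) :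
    ∃ c : Code, ∀ j, A j = true ↔ ∃ t, stageReal c t j = true := by
  obtain ⟨c, hc⟩ := Code.exists_code.1 hA
  refine ⟨c, fun j => ?_⟩
  rw [exists_stageReal_iff, hc]
  simp [Part.assert]

theorem primrecPred_stageReal_mem_cylinder {α : Type*} [Primcodable α] (c : Code) {t : α → ℕ}
    {σ : α → List Bool} (ht : Primrec t) (hσ : Primrec σ) :
    PrimrecPred fun a => stageReal c (t a) ∈ cylinder (σ a) := by
  have hR : PrimrecRel fun (j : ℕ) (a : α) => stageReal c (t a) j = (σ a).getD j false :=
    Primrec.eq.comp (primrec_stageReal (Primrec.const c) (ht.comp Primrec.snd) Primrec.fst)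
      ((Primrec.list_getD false).comp (hσ.comp Primrec.snd) Primrec.fst)
  refine (hR.forall_mem_list.comp (Primrec.list_range.comp (Primrec.list_length.comp hσ))
    Primrec.id).of_eq fun a => ?_
  simp [mem_cylinder_iff]

/-- If the stages of an r.e. set `A` pass through `[σ]` at stage `t`, and `A` is in `[σ]` too, then
they stay in `[σ]` from then on. -/
theorem stageReal_mem_cylinder_of_le {A : Cantor} {c : Code}
    (hc : ∀ j, A j = true ↔ ∃ t, stageReal c t j = true) {σ : List Bool} {t u : ℕ} (htu : t ≤ u)
    (ht : stageReal c t ∈ cylinder σ) (hA : A ∈ cylinder σ) : stageReal c u ∈ cylinder σ := by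
  intro j hj
  rw [← hA j hj]
  cases hAj : A j with
  | false =>
    by_contra h
    rw [(hc j).2 ⟨u, by simpa using h⟩] at hAj
    simp at hAj
  | true => exact stageReal_mono c htu (by rw [ht j hj, ← hA j hj, hAj])

theorem mem_cylinder_initSeg {X Y : Cantor} {n : ℕ} :
    X ∈ cylinder (initSeg Y n) ↔ ∀ j < n, X j = Y j := by
  simp [cylinder, initSeg]

theorem exists_stageReal_mem_cylinder {A : Cantor} {c : Code}
    (hc : ∀ j, A j = true ↔ ∃ t, stageReal c t j = true) (n : ℕ) :
    ∃ t, stageReal c t ∈ cylinder (initSeg A n) := by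
  simp only [mem_cylinder_initSeg]
  induction n with
  | zero => simp
  | succ n ih =>
    obtain ⟨t, ht⟩ := ih
    obtain ⟨u, hu⟩ : ∃ u, t ≤ u ∧ stageReal c u n = A n := by
      cases hAn : A n with
      | false =>
        refine ⟨t, le_rfl, ?_⟩
        by_contra h
        rw [(hc n).2 ⟨t, by simpa using h⟩] at hAn
        simp at hAn
      | true =>
        obtain ⟨u, hu⟩ := (hc n).1 hAn
        exact ⟨max t u, le_max_left _ _, stageReal_mono c (le_max_right _ _) hu⟩
    refine ⟨u, fun j hj => ?_⟩
    rcases (Nat.lt_succ_iff.1 hj).lt_or_eq with hj | rfl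
    · have h := stageReal_mem_cylinder_of_le hc (σ := initSeg A n) hu.1
        (mem_cylinder_initSeg.2 ht) (mem_cylinder_initSeg.2 fun _ _ => rfl)
      exact mem_cylinder_initSeg.1 h j hj
    · exact hu.2

/-- Whether the `e`-th partial recursive function halts on input `e` within `t` steps. -/
def haltsBy (t e : ℕ) : Bool := stageReal (Denumerable.ofNat Code e) t e

theorem haltsBy_mono {t u e : ℕ} (h : t ≤ u) (he : haltsBy t e = true) : haltsBy u e = true :=
  stageReal_mono _ h he

theorem haltingReal_iff {e : ℕ} : haltingReal e = true ↔ ∃ t, haltsBy t e = true := by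
  simp only [haltsBy, exists_stageReal_iff, haltingReal, decide_eq_true_eq]

theorem primrec_haltsBy : Primrec₂ haltsBy :=
  primrec_stageReal ((Primrec.ofNat Code).comp Primrec.snd) Primrec.fst Primrec.snd

theorem exists_haltsBy_bound (n : ℕ) :
    ∃ t, ∀ e ≤ n, haltingReal e = true → haltsBy t e = true := by
  induction n with
  | zero =>
    by_cases h : haltingReal 0 = true
    · obtain ⟨t, ht⟩ := haltingReal_iff.1 h
      exact ⟨t, fun e he _ => by rwa [Nat.le_zero.1 he]⟩
    · exact ⟨0, fun e he h' => by rw [Nat.le_zero.1 he] at h'; exact absurd h' h⟩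
  | succ n ih =>
    obtain ⟨t, ht⟩ := ih
    by_cases h : haltingReal (n + 1) = true
    · obtain ⟨u, hu⟩ := haltingReal_iff.1 h
      refine ⟨max t u, fun e he h' => ?_⟩
      rcases Nat.le_succ_iff.1 he with he | rfl
      · exact haltsBy_mono (le_max_left _ _) (ht e he h')
      · exact haltsBy_mono (le_max_right _ _) hu
    · refine ⟨t, fun e he h' => ?_⟩
      rcases Nat.le_succ_iff.1 he with he | rfl
      · exact ht e he h'
      · exact absurd h' h

/-- The strings that catch the r.e. set with code `c` when `m` is enumerated into `∅'`: those of
measure less than `2^{-m}` that are initial segments of its approximation at that very stage. -/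
def catchers (μ : ProbabilityMeasure Cantor) (c : Code) (m : ℕ) : Set (List Bool) :=
  {σ | (μ : Measure Cantor).real (cylinder σ) < (1 / 2 : ℝ) ^ m ∧
    ∃ t, haltsBy t m = false ∧ haltsBy (t + 1) m = true ∧ stageReal c t ∈ cylinder σ}

/-- Since `m` enters `∅'` at one stage only, the catchers are initial segments of one real, and the
shortest of them determines the largest cylinder. -/
theorem measure_biUnion_catchers_le (μ : ProbabilityMeasure Cantor) (c : Code) (m : ℕ) :
    (μ : Measure Cantor) (⋃ σ ∈ catchers μ c m, cylinder σ) ≤ 2⁻¹ ^ m := by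
  rcases (catchers μ c m).eq_empty_or_nonempty with h | h
  · simp [h]
  obtain ⟨σ, hσ, hmin⟩ := (measure List.length).wf.has_min _ h
  have hsub : (⋃ τ ∈ catchers μ c m, cylinder τ) ⊆ cylinder σ := by
    refine Set.iUnion₂_subset fun τ hτ => ?_
    obtain ⟨-, t, ht0, ht1, ht⟩ := hσ
    obtain ⟨-, u, hu0, hu1, hu⟩ := id hτ
    have hle : ∀ {a b : ℕ}, haltsBy a m = false → haltsBy (b + 1) m = true → a ≤ b := by
      intro a b ha hb
      by_contra! hab
      rw [haltsBy_mono hab hb] at ha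
      simp at ha
    obtain rfl : t = u := le_antisymm (hle ht0 hu1) (hle hu0 ht1)
    have hlen : σ.length ≤ τ.length := not_lt.1 (hmin τ hτ)
    intro X hX j hj
    rw [hX j (by omega), ← hu j (by omega), ht j hj]
  refine (measure_mono hsub).trans ?_
  rw [← ofReal_measureReal (by finiteness)]
  refine (ENNReal.ofReal_le_ofReal hσ.1.le).trans_eq ?_
  rw [ENNReal.ofReal_pow (by norm_num), one_div, ENNReal.ofReal_inv_of_pos (by norm_num)]
  simp

/-- The `n`-th class of the test: the union of the cylinders of the catchers for all `m > n`. -/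
def catchTest (μ : ProbabilityMeasure Cantor) (c : Code) (n : ℕ) : Set Cantor :=
  ⋃ σ ∈ {σ | ∃ m, n < m ∧ σ ∈ catchers μ c m}, cylinder σ

theorem measureReal_catchTest_le (μ : ProbabilityMeasure Cantor) (c : Code) (n : ℕ) :
    (μ : Measure Cantor).real (catchTest μ c n) ≤ (1 / 2 : ℝ) ^ n := by
  have hsub : catchTest μ c n ⊆ ⋃ i : ℕ, ⋃ σ ∈ catchers μ c (n + 1 + i), cylinder σ := by
    refine Set.iUnion₂_subset fun σ ⟨m, hm, hσ⟩ => ?_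
    obtain ⟨i, rfl⟩ := Nat.exists_eq_add_of_le (Nat.succ_le_of_lt hm)
    exact Set.subset_iUnion_of_subset i (Set.subset_biUnion_of_mem (u := cylinder) hσ)
  have h : (μ : Measure Cantor) (catchTest μ c n) ≤ 2⁻¹ ^ n := by
    calc (μ : Measure Cantor) (catchTest μ c n)
        ≤ ∑' i : ℕ, (μ : Measure Cantor) (⋃ σ ∈ catchers μ c (n + 1 + i), cylinder σ) :=
          (measure_mono hsub).trans (measure_iUnion_le _)
      _ ≤ ∑' i : ℕ, 2⁻¹ ^ (n + 1) * 2⁻¹ ^ i := ENNReal.tsum_le_tsum fun i => by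
          rw [← pow_add]
          exact measure_biUnion_catchers_le μ c _
      _ = 2⁻¹ ^ n := by
          rw [ENNReal.tsum_mul_left, ENNReal.tsum_geometric_two, pow_succ, mul_assoc,
            ENNReal.inv_mul_cancel (by norm_num) (by norm_num), mul_one]
  refine (ENNReal.toReal_mono (by finiteness) h).trans_eq ?_
  simp

theorem uniformlySigma01_catchTest (R B : Cantor) (c : Code) :
    UniformlySigma01 (oplus R B) (catchTest (rho R) c) := by
  refine ⟨{p | ∃ m, p.1 < m ∧ p.2 ∈ catchers (rho R) c m}, ?_, fun n => rfl⟩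
  -- The length of the inspected initial segment codes `(_, t, m, s)`.
  have hk : Primrec fun q : (ℕ × List Bool) × List Bool => q.2.length :=
    Primrec.list_length.comp Primrec.snd
  have hu := Primrec.snd.comp (Primrec.unpair.comp hk)
  have ht := Primrec.fst.comp (Primrec.unpair.comp hu)
  have hv := Primrec.unpair.comp (Primrec.snd.comp (Primrec.unpair.comp hu))
  have hm := Primrec.fst.comp hv
  have hs := Primrec.snd.comp hv
  have hσ : Primrec fun q : (ℕ × List Bool) × List Bool => q.1.2 := Primrec.snd.comp Primrec.fst
  have hP := (Primrec.nat_le.comp (Primrec.nat_mul.comp (Primrec.const 2)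
      (primrec_blockBound.comp hs)) hk).and
    ((Primrec.nat_lt.comp (Primrec.fst.comp Primrec.fst) hm).and
    ((primrecPred_certifiedSmall Primrec.snd hs hσ hm).and
    ((Primrec.eq.comp (primrec_haltsBy.comp ht hm) (Primrec.const false)).and
    ((Primrec.eq.comp (primrec_haltsBy.comp (Primrec.succ.comp ht) hm) (Primrec.const true)).and
    (primrecPred_stageReal_mem_cylinder c ht hσ)))))
  refine reIn_of_search _ hP.primrecRel fun p => ?_
  simp only [length_initSeg, Set.mem_ofPred_eq]
  constructor
  · rintro ⟨m, hpm, hsmall, t, ht0, ht1, htσ⟩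
    obtain ⟨s, hs⟩ := exists_certifiedSmall hsmall
    refine ⟨Nat.pair (2 * blockBound s) (Nat.pair t (Nat.pair m s)), ?_⟩
    simp only [Nat.unpair_pair]
    have hle := Nat.left_le_pair (2 * blockBound s) (Nat.pair t (Nat.pair m s))
    exact ⟨hle, hpm, (certifiedSmall_congr (leftHalf_initSeg_oplus R B hle) _ _).2 hs,
      ht0, ht1, htσ⟩
  · rintro ⟨k, hle, hpm, hs, ht0, ht1, htσ⟩
    exact ⟨_, hpm, ((certifiedSmall_congr (leftHalf_initSeg_oplus R B hle) _ _).1 hs).rho_lt,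
      _, ht0, ht1, htσ⟩

/-- Once the approximation to `A` has reached a cylinder around `A` of measure less than `2^{-m}`,
it is too late for `m` to enter `∅'`, unless the test catches `A`. -/
theorem haltsBy_of_notMem_catchTest {μ : ProbabilityMeasure Cantor} {A : Cantor} {c : Code}
    (hc : ∀ j, A j = true ↔ ∃ t, stageReal c t j = true) {n m t : ℕ} {σ : List Bool}
    (hA : A ∉ catchTest μ c n) (hnm : n < m) (ht : stageReal c t ∈ cylinder σ)
    (hAσ : A ∈ cylinder σ) (hσ : (μ : Measure Cantor).real (cylinder σ) < (1 / 2 : ℝ) ^ m)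
    (hm : haltingReal m = true) : haltsBy t m = true := by
  by_contra hnot
  have hex := haltingReal_iff.1 hm
  obtain ⟨u, hu⟩ : ∃ u, Nat.find hex = u + 1 := by
    refine Nat.exists_eq_succ_of_ne_zero fun h0 => ?_
    exact hnot (haltsBy_mono (by omega) (Nat.find_spec hex))
  have hu1 : haltsBy (u + 1) m = true := hu ▸ Nat.find_spec hex
  have hu0 : haltsBy u m = false := by simpa using Nat.find_min hex (m := u) (by omega)
  have htu : t ≤ u := by
    by_contra! h
    exact hnot (haltsBy_mono h hu1)
  exact hA (Set.mem_biUnion (t := cylinder)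
    ⟨m, hnm, hσ, u, hu0, hu1, stageReal_mem_cylinder_of_le hc htu ht hAσ⟩ hAσ)

theorem exists_measureReal_cylinder_lt {μ : ProbabilityMeasure Cantor} {A : Cantor}
    (hA : ¬ IsAtomOf A μ) {r : ℝ} (hr : 0 < r) :
    ∃ l, (μ : Measure Cantor).real (cylinder (initSeg A l)) < r := by
  have hinter : ⋂ l, cylinder (initSeg A l) = {A} := by
    ext X
    simp only [Set.mem_iInter, mem_cylinder_initSeg, Set.mem_singleton_iff]
    exact ⟨fun h => funext fun j => h (j + 1) j j.lt_succ_self, fun h _ _ _ => h ▸ rfl⟩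
  have hlim := tendsto_measure_iInter_atTop (μ := (μ : Measure Cantor))
    (s := fun l => cylinder (initSeg A l))
    (fun l => (isClopen_cylinder _).isOpen.measurableSet.nullMeasurableSet)
    (fun a b hab X hX => mem_cylinder_initSeg.2 fun j hj =>
      mem_cylinder_initSeg.1 hX j (hj.trans_le hab)) ⟨0, by finiteness⟩
  rw [hinter, not_not.1 hA] at hlim
  have hreal := (ENNReal.tendsto_toReal ENNReal.zero_ne_top).comp hlim
  exact (hreal.eventually_lt_const hr).exists

/-- The first `n` bits of the right half of a finite initial segment of a join. -/
def rightSeg (l : List Bool) (n : ℕ) : List Bool :=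
  (List.range n).map fun i => l.getD (2 * i + 1) false

theorem rightSeg_initSeg_oplus (R A : Cantor) {n k : ℕ} (hk : 2 * n ≤ k) :
    rightSeg (initSeg (oplus R A) k) n = initSeg A n := by
  refine List.map_congr_left fun i hi => ?_
  rw [List.mem_range] at hi
  rw [initSeg_getD _ (by omega)]
  simp [oplus, Nat.add_mod, show (2 * i + 1) / 2 = i by omega]

theorem primrec_rightSeg : Primrec₂ rightSeg := by
  refine Primrec.list_map (Primrec.list_range.comp Primrec.snd) ?_
  exact (Primrec.list_getD false).comp (Primrec.fst.comp Primrec.fst)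
    (Primrec.succ.comp (Primrec.nat_mul.comp (Primrec.const 2) Primrec.snd))

/-- The reduction: with `R ⊕ A` as an oracle, find an initial segment of `A` certified to have measure
less than `2^{-m}`, wait until the approximation to `A` reaches it, and see whether `m` is in `∅'`
by then. -/
theorem haltingReal_le_oplus {R A : Cantor} {c : Code}
    (hc : ∀ j, A j = true ↔ ∃ t, stageReal c t j = true) (hatom : ¬ IsAtomOf A (rho R)) {n : ℕ}
    (hA : A ∉ catchTest (rho R) c n) : TuringLE haltingReal (oplus R A) := by
  -- The test says nothing about `m ≤ n`; waiting `t₀` further steps settles these finitely many.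
  obtain ⟨t₀, ht₀⟩ := exists_haltsBy_bound n
  -- The length of the inspected initial segment codes `(_, t, s, l)`.
  have hk : Primrec fun q : ℕ × List Bool => q.2.length :=
    Primrec.list_length.comp Primrec.snd
  have hu := Primrec.snd.comp (Primrec.unpair.comp hk)
  have ht := Primrec.fst.comp (Primrec.unpair.comp hu)
  have hv := Primrec.unpair.comp (Primrec.snd.comp (Primrec.unpair.comp hu))
  have hs := Primrec.fst.comp hv
  have hl := Primrec.snd.comp hv
  have hσ := primrec_rightSeg.comp Primrec.snd hl
  have h2 : ∀ {f : ℕ × List Bool → ℕ}, Primrec f → Primrec fun q => 2 * f q :=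
    fun hf => Primrec.nat_mul.comp (Primrec.const 2) hf
  have hP := (Primrec.nat_le.comp (h2 (primrec_blockBound.comp hs)) hk).and
    ((Primrec.nat_le.comp (h2 hl) hk).and
    ((primrecPred_certifiedSmall Primrec.snd hs hσ Primrec.fst).and
    (primrecPred_stageReal_mem_cylinder c ht hσ)))
  have hg := primrec_haltsBy.comp (Primrec.nat_add.comp ht (Primrec.const t₀)) Primrec.fst
  refine turingLE_of_search hP.primrecRel hg.to₂ (fun m => ?_) fun m k hmk => ?_
  · obtain ⟨l, hl⟩ := exists_measureReal_cylinder_lt hatom (r := (1 / 2 : ℝ) ^ m) (by positivity)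
    obtain ⟨s, hs⟩ := exists_certifiedSmall hl
    obtain ⟨t, ht⟩ := exists_stageReal_mem_cylinder hc l
    refine ⟨Nat.pair (max (2 * blockBound s) (2 * l)) (Nat.pair t (Nat.pair s l)), ?_⟩
    have hle := Nat.left_le_pair (max (2 * blockBound s) (2 * l)) (Nat.pair t (Nat.pair s l))
    have hle1 := (le_max_left _ _).trans hle
    have hle2 := (le_max_right _ _).trans hle
    simp only [length_initSeg, Nat.unpair_pair, rightSeg_initSeg_oplus R A hle2]
    exact ⟨hle1, hle2, (certifiedSmall_congr (leftHalf_initSeg_oplus R A hle1) _ _).2 hs, ht⟩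
  · simp only [length_initSeg] at hmk ⊢
    obtain ⟨hle1, hle2, hs, ht⟩ := hmk
    rw [rightSeg_initSeg_oplus R A hle2] at hs ht
    have hsmall := ((certifiedSmall_congr (leftHalf_initSeg_oplus R A hle1) _ _).1 hs).rho_lt
    rw [Bool.eq_iff_iff]
    refine ⟨fun h => haltingReal_iff.2 ⟨_, h⟩, fun h => ?_⟩
    rcases le_or_gt m n with hmn | hmn
    · exact haltsBy_mono (Nat.le_add_left _ _) (ht₀ m hmn h)
    · exact haltsBy_mono (Nat.le_add_right _ _) (haltsBy_of_notMem_catchTest hc hA hmn ht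
        (mem_cylinder_initSeg.2 fun _ _ => rfl) hsmall h)

end CantorRandom

open CantorRandom

theorem mainTheorem2 (μ : ProbabilityMeasure Cantor) (R A : Cantor)
    (hR : IsRepresentation R μ) (hre : IsRE A) (hrandom : A ∈ MLR μ emptyReal)
    (hatom : ¬ IsAtomOf A μ) :
    TuringLE haltingReal (oplus R A) := by
  obtain ⟨c, hc⟩ := hre.exists_code
  obtain ⟨S, hS, hSA⟩ := hrandom
  have htest : IsTest μ S emptyReal (catchTest μ c) :=
    ⟨hS ▸ uniformlySigma01_catchTest S emptyReal c, measureReal_catchTest_le μ c⟩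
  obtain ⟨n, hn⟩ : ∃ n, A ∉ catchTest μ c n := by
    simpa using hSA _ htest
  obtain rfl : rho R = μ := hR
  exact haltingReal_le_oplus hc hatom hn
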